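/- **Theorem 5.1 (Inverse Function Theorem).** Let $\mathbb{K}$ be a field with a non-trivial absolute value $|\cdot|$ (not necessarily complete), and let $E$ be a Banach space over $\mathbb{K}$, i.e. a complete normed $\mathbb{K}$-vector space. Let $U\subseteq E$ be open, $k\in\{1,2,\dots\}\cup\{\infty\}$, and let $f\colon U\to E$ be a $C^k$-map (resp. an $SC^k$-map, resp. an $LC^k$-map), as defined below. In the $C^k$-case, assume that $k\ge 2$, or that $\mathbb{K}$ is locally compact and $\dim_{\mathbb K} E<\infty$. If $x\in U$ and $f'(x)\in \mathrm{GL}(E)$, i.e. $f'(x)$ is a continuous linear map having a continuous linear inverse, then there is an open neighborhood $V\subseteq U$ of $x$ such that $f(V)$ is open in $E$ and $f|_V\colon V\to f(V)$ is a $C^k$-diffeomorphism (resp. an $SC^k$-diffeomorphism, resp. an $LC^k$-diffeomorphism), i.e. a bijection which is $C^k$ (resp. $SC^k$, resp. $LC^k$) and whose inverse $f(V)\to V$ is also $C^k$ (resp. $SC^k$, resp. $LC^k$). *Definitions.* Let $X,Y$ be Hausdorff topological $\mathbb{K}$-vector spaces, $W\subseteq X$ open, and $h\colon W\to Y$ a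 map. - Put $W^{[1]}:=\{(x,y,t)\in W\times X\times\mathbb{K} : x+ty\in W\}$, an open subset of $X\times X\times \mathbb{K}$. The map $h$ is $C^0$ if it is continuous. It is $C^1$ if it is continuous and there is a (necessarily unique) continuous map $h^{[1]}\colon W^{[1]}\to Y$ with $h^{[1]}(x,y,t)=\frac1t\bigl(h(x+ty)-h(x)\bigr)$ whenever $t\neq0$; then $h'(x):=h^{[1]}(x,\cdot,0)\colon X\to Y$. For $k\ge2$, $h$ is $C^k$ if it is $C^1$ and $h^{[1]}$ is $C^{k-1}$; it is $C^\infty$ if it is $C^k$ for all $k\in\mathbb{N}_0$. Put $h^{[0]}:=h$, $W^{[0]}:=W$, $h^{[j+1]}:=(h^{[1]})^{[j]}$ and $W^{[j+1]}:=(W^{[1]})^{[j]}$. - A *gauge* on $X$ is an upper semicontinuous function $\gamma\colon X\to[0,\infty[$ with $\gamma(tx)=|t|\gamma(x)$ for all $t\in\mathbb{K}$, $x\in X$. - $h$ is *Lipschitz continuous* if for all $x_0\in W$ and each gauge $\gamma$ on $Y$ there are a gauge $\eta$ on $X$ and $\delta>0$ such that $\gamma(h(y)-h(x))\le\eta(y-x)$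 for all $x,y\in W$ with $\eta(x-x_0)<\delta$ and $\eta(y-x_0)<\delta$. (For normed spaces this means: locally Lipschitz.) - $h$ is *strictly differentiable* if for each $x\in W$ there is a continuous linear map $A\colon X\to Y$ such that for each gauge $\gamma$ on $Y$ there is a gauge $\eta$ on $X$ such that for each $\varepsilon>0$ there is $\delta>0$ with $\gamma\bigl(h(z)-h(y)-A(z-y)\bigr)\le\varepsilon\,\eta(z-y)$ for all $y,z\in W$ with $\eta(z-x)<\delta$ and $\eta(y-x)<\delta$. (For normed spaces one may take the norms as $\gamma$ and $\eta$.) - $h$ is $SC^k$ if it is $C^k$ and $h^{[j]}$ is strictly differentiable for all $j\in\mathbb{N}_0$ with $j<k$; $h$ is $LC^k$ if it is $C^k$ and $h^{[j]}$ is Lipschitz continuous for all $j\in\mathbb{N}_0$ with $j\le k$. -/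

import Mathlib

open Set Topology

universe u v

namespace BGN

section General

variable (𝕂 : Type u) [NontriviallyNormedField 𝕂]
variable {E : Type u} [AddCommGroup E] [Module 𝕂 E] [TopologicalSpace E]
variable {F : Type v} [AddCommGroup F] [Module 𝕂 F] [TopologicalSpace F]

/-- The domain `U^[1] = {(x, y, t) ∈ U × E × 𝕂 : x + t y ∈ U}` of the extended
difference quotient map of a function on `U`. -/
def dom1 (U : Set E) : Set (E × E × 𝕂) :=
  {p | p.1 ∈ U ∧ p.1 + p.2.2 • p.2.1 ∈ U}

/-- `g` is (on `U^[1]`) the extended difference quotient map `f^[1]` of `f : U → F`: it is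
continuous on `U^[1]` and `g (x, y, t) = t⁻¹ (f (x + t y) - f x)` whenever `t ≠ 0`.
Functions on `U` are represented by functions on the whole space, of which only the values
on `U` matter. If `U` has dense interior (for instance, if `U` is open) and `F` is a Hausdorff
topological vector space, then these conditions determine `g` on `U^[1]`. -/
structure IsExtDiffQuot (U : Set E) (f : E → F) (g : E × E × 𝕂 → F) : Prop where
  continuousOn : ContinuousOn g (dom1 𝕂 U)
  eq_quot : ∀ (x y : E) (t : 𝕂), (x, y, t) ∈ dom1 𝕂 U → t ≠ 0 →
    g (x, y, t) = t⁻¹ • (f (x + t • y) - f x)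

/-- `A` is the differential `f'(x) = df(x, ·) = f^[1](x, ·, 0)` of `f : U → F` at `x ∈ U`. -/
def HasDifferentialAt (U : Set E) (f : E → F) (x : E) (A : E →L[𝕂] F) : Prop :=
  ∃ g : E × E × 𝕂 → F, IsExtDiffQuot 𝕂 U f g ∧ ∀ y : E, g (x, y, 0) = A y

/-- A gauge on a topological vector space over a valued field. -/
structure IsGauge (γ : F → ℝ) : Prop where
  upperSemicontinuous : UpperSemicontinuous γ
  nonneg : ∀ x, 0 ≤ γ x
  map_smul : ∀ (t : 𝕂) (x : F), γ (t • x) = ‖t‖ * γ x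

/-- Lipschitz continuity of `f : U → F`. -/
def LipschitzContOn (U : Set E) (f : E → F) : Prop :=
  ∀ x₀ ∈ U, ∀ γ : F → ℝ, IsGauge 𝕂 γ → ∃ η : E → ℝ, IsGauge 𝕂 η ∧ ∃ δ > 0,
    ∀ x ∈ U, ∀ y ∈ U, η (x - x₀) < δ → η (y - x₀) < δ → γ (f y - f x) ≤ η (y - x)

/-- Strict differentiability of `f : U → F` at `x`. -/
def StrictDiffAt (U : Set E) (f : E → F) (x : E) : Prop :=
  ∃ A : E →L[𝕂] F, ∀ γ : F → ℝ, IsGauge 𝕂 γ → ∃ η : E → ℝ, IsGauge 𝕂 η ∧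
    ∀ ε > 0, ∃ δ > 0, ∀ y ∈ U, ∀ z ∈ U, η (z - x) < δ → η (y - x) < δ →
      γ (f z - f y - A (z - y)) ≤ ε * η (z - y)

/-- Strict differentiability of `f : U → F` at each point of `U`. -/
def StrictDiffOn (U : Set E) (f : E → F) : Prop :=
  ∀ x ∈ U, StrictDiffAt 𝕂 U f x

end General

section Classes

variable (𝕂 : Type u) [NontriviallyNormedField 𝕂]
variable {F : Type v} [AddCommGroup F] [Module 𝕂 F] [TopologicalSpace F]

/-- `f : U → F` is `C^n`: `f` is continuous and, if `n ≥ 1`, the map `f^[1]` exists and is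
`C^(n-1)` on `U^[1]`. -/
def CNat : (n : ℕ) → {E : Type u} → [AddCommGroup E] → [Module 𝕂 E] → [TopologicalSpace E] →
    Set E → (E → F) → Prop
  | 0, _, _, _, _, U, f => ContinuousOn f U
  | n + 1, E, _, _, _, U, f => ContinuousOn f U ∧
      ∃ g : E × E × 𝕂 → F, IsExtDiffQuot 𝕂 U f g ∧ CNat n (dom1 𝕂 U) g

/-- `f : U → F` is `SC^n`: `f` is `C^n`, and `f^[j]` is strictly differentiable on `U^[j]` for
all `j < n`. -/
def SCNat : (n : ℕ) → {E : Type u} → [AddCommGroup E] → [Module 𝕂 E] → [TopologicalSpace E] →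
    Set E → (E → F) → Prop
  | 0, _, _, _, _, U, f => ContinuousOn f U
  | n + 1, E, _, _, _, U, f => ContinuousOn f U ∧ StrictDiffOn 𝕂 U f ∧
      ∃ g : E × E × 𝕂 → F, IsExtDiffQuot 𝕂 U f g ∧ SCNat n (dom1 𝕂 U) g

/-- `f : U → F` is `LC^n`: `f` is `C^n`, and `f^[j]` is Lipschitz continuous on `U^[j]` for
all `j ≤ n`. -/
def LCNat : (n : ℕ) → {E : Type u} → [AddCommGroup E] → [Module 𝕂 E] → [TopologicalSpace E] →
    Set E → (E → F) → Prop
  | 0, _, _, _, _, U, f => ContinuousOn f U ∧ LipschitzContOn 𝕂 U f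
  | n + 1, E, _, _, _, U, f => ContinuousOn f U ∧ LipschitzContOn 𝕂 U f ∧
      ∃ g : E × E × 𝕂 → F, IsExtDiffQuot 𝕂 U f g ∧ LCNat n (dom1 𝕂 U) g

/-- The three kinds of differentiability. -/
inductive DiffKind
  | C
  | SC
  | LC

/-- `f : U → F` is `C^k`, `SC^k`, respectively `LC^k`, where `k ∈ ℕ ∪ {∞}`. -/
def OfClass {E : Type u} [AddCommGroup E] [Module 𝕂 E] [TopologicalSpace E]
    (c : DiffKind) (k : ℕ∞) (U : Set E) (f : E → F) : Prop :=
  ∀ n : ℕ, (n : ℕ∞) ≤ k →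
    match c with
    | .C => CNat 𝕂 n U f
    | .SC => SCNat 𝕂 n U f
    | .LC => LCNat 𝕂 n U f

end Classes

/-- `f` restricts to a `C^k`-, `SC^k`-, respectively `LC^k`-diffeomorphism from `V` onto `W`: it
maps `V` bijectively onto `W`, and `f : V → W` and its inverse `W → V` are of the given class. -/
def IsDiffeoOn (𝕂 : Type u) [NontriviallyNormedField 𝕂]
    {E : Type u} [AddCommGroup E] [Module 𝕂 E] [TopologicalSpace E]
    {F : Type u} [AddCommGroup F] [Module 𝕂 F] [TopologicalSpace F]
    (c : DiffKind) (k : ℕ∞) (V : Set E) (W : Set F) (f : E → F) : Prop :=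
  BijOn f V W ∧ OfClass 𝕂 c k V f ∧ ∃ g : F → E, InvOn g f V W ∧ OfClass 𝕂 c k W g

end BGN

/-! The theorem splits into producing a homeomorphic inverse and showing that it is as regular as
`f`. The inverse comes from strict differentiability at `x`: near `x`, `f` is a small Lipschitz
perturbation of the invertible map `A`, hence injective and open.
`HasDifferentialAt.hasStrictFDerivAt` shows that the hypotheses of each class force strict
differentiability. For regularity, `g = f⁻¹` satisfies `g y = F (y, g y)` with `F (y, u) = u + A⁻¹
(y - f u)`, a contraction in `u` uniformly in `y`. `Reg.fixedPoint` shows that fixed points of such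
a family inherit its class. The key is self-reproduction: if `φ p` is the fixed point of `F (p, ·)`,
then `φ^[1] (p, q, t)` is the fixed point of `w ↦ F^[1] ((p, φ p), (q, w), t)`, which contracts with
the same constant, so induction on the order applies. -/

namespace BGN

open Filter Asymptotics
open scoped NNReal

/-! ### Gauges reduce to norms. -/

section Gauges

variable {𝕂 : Type u} [NontriviallyNormedField 𝕂]
variable {E : Type u} [NormedAddCommGroup E] [NormedSpace 𝕂 E]
variable {F : Type u} [NormedAddCommGroup F] [NormedSpace 𝕂 F]

variable (𝕂) in
theorem isOpen_dom1 {U : Set E} (hU : IsOpen U) : IsOpen (dom1 𝕂 U) :=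
  (hU.preimage continuous_fst).inter
    (hU.preimage (f := fun p : E × E × 𝕂 => p.1 + p.2.2 • p.2.1) (by fun_prop))

variable (𝕂) in
theorem dom1_mono {U V : Set E} (h : V ⊆ U) : dom1 𝕂 V ⊆ dom1 𝕂 U :=
  fun _ hp => ⟨h hp.1, h hp.2⟩

/-- A gauge on a normed space is dominated by a multiple of the norm. -/
theorem IsGauge.exists_le_mul_norm {γ : E → ℝ} (hγ : IsGauge 𝕂 γ) :
    ∃ C > 0, ∀ x, γ x ≤ C * ‖x‖ := by
  obtain ⟨c, hc⟩ := NormedField.exists_one_lt_norm 𝕂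
  have h0 : γ 0 = 0 := by simpa using hγ.map_smul 0 0
  obtain ⟨r, hr, hball⟩ := Metric.eventually_nhds_iff.1
    (hγ.upperSemicontinuous 0 1 (h0.trans_lt one_pos))
  refine ⟨r⁻¹ * ‖c‖, by positivity, fun x => ?_⟩
  rcases eq_or_ne x 0 with rfl | hx
  · simp [h0]
  -- The values of `‖·‖` on `𝕂` may be discrete, so `x` cannot be normalised exactly; powers of `c`
  -- do so up to the factor `‖c‖`.
  obtain ⟨d, hd, hdx, -, hle⟩ := rescale_to_shell hc hr hx
  have h1 : γ (d • x) < 1 := hball (by simpa using hdx)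
  rw [hγ.map_smul] at h1
  have hd' : 0 < ‖d‖ := norm_pos_iff.2 hd
  refine le_trans ?_ hle
  rw [← one_div, le_div_iff₀ hd']
  linarith

variable (𝕂) in
theorem isGauge_mul_norm {M : ℝ} (hM : 0 ≤ M) : IsGauge 𝕂 (fun x : E => M * ‖x‖) where
  upperSemicontinuous := (continuous_const.mul continuous_norm).upperSemicontinuous
  nonneg x := by positivity
  map_smul t x := by rw [norm_smul]; ring

variable (𝕂) in
theorem isGauge_norm : IsGauge 𝕂 (fun x : E => ‖x‖) := by
  simpa using isGauge_mul_norm 𝕂 (E := E) zero_le_one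

theorem lipschitzContOn_iff {U : Set E} (hU : IsOpen U) {f : E → F} :
    LipschitzContOn 𝕂 U f ↔ ∀ x ∈ U, ∃ K : ℝ≥0, ∃ s ∈ 𝓝 x, LipschitzOnWith K f s := by
  constructor
  · intro h x hx
    obtain ⟨η, hη, δ, hδ, H⟩ := h x hx _ (isGauge_norm 𝕂)
    obtain ⟨C, hC, hηC⟩ := hη.exists_le_mul_norm
    refine ⟨C.toNNReal, U ∩ Metric.ball x (δ / C),
      inter_mem (hU.mem_nhds hx) (Metric.ball_mem_nhds _ (by positivity)), ?_⟩
    have key : ∀ y ∈ Metric.ball x (δ / C), η (y - x) < δ := fun y hy => by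
      rw [mem_ball_iff_norm, lt_div_iff₀ hC] at hy
      linarith [hηC (y - x)]
    refine LipschitzOnWith.of_dist_le_mul fun y hy z hz => ?_
    rw [dist_eq_norm, dist_eq_norm, Real.coe_toNNReal _ hC.le]
    exact (H z hz.1 y hy.1 (key z hz.2) (key y hy.2)).trans (hηC _)
  · intro h x hx γ hγ
    obtain ⟨C, hC, hγC⟩ := hγ.exists_le_mul_norm
    obtain ⟨K, s, hs, hf⟩ := h x hx
    obtain ⟨δ, hδ, hball⟩ := Metric.mem_nhds_iff.1 hs
    -- The summand `1` makes the gauge dominate the norm, so its `δ`-ball lies in the norm ball of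
    -- radius `δ`.
    refine ⟨fun y => (C * K + 1) * ‖y‖, isGauge_mul_norm 𝕂 (by positivity), δ, hδ, ?_⟩
    have key : ∀ y, (C * K + 1) * ‖y - x‖ < δ → y ∈ s := fun y hy => by
      refine hball (mem_ball_iff_norm.2 (lt_of_le_of_lt ?_ hy))
      exact le_mul_of_one_le_left (norm_nonneg _) (by simp; positivity)
    intro y _ z _ hy hz
    have h1 := hf.norm_sub_le (key z hz) (key y hy)
    calc γ (f z - f y) ≤ C * ‖f z - f y‖ := hγC _
      _ ≤ C * (K * ‖z - y‖) := by gcongr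
      _ ≤ (C * K + 1) * ‖z - y‖ := by nlinarith [norm_nonneg (z - y)]

theorem strictDiffAt_iff {U : Set E} (hU : IsOpen U) {f : E → F} {x : E} (hx : x ∈ U) :
    StrictDiffAt 𝕂 U f x ↔ ∃ A : E →L[𝕂] F, HasStrictFDerivAt f A x := by
  refine exists_congr fun A => ?_
  rw [hasStrictFDerivAt_iff_isLittleO, isLittleO_iff]
  constructor
  · intro h ε hε
    obtain ⟨η, hη, H⟩ := h _ (isGauge_norm 𝕂)
    obtain ⟨C, hC, hηC⟩ := hη.exists_le_mul_norm
    obtain ⟨δ, hδ, H⟩ := H (ε / C) (by positivity)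
    have key : ∀ᶠ y in 𝓝 x, y ∈ U ∧ η (y - x) < δ := by
      filter_upwards [hU.mem_nhds hx, Metric.ball_mem_nhds x (show 0 < δ / C by positivity)]
        with y hyU hy
      rw [mem_ball_iff_norm, lt_div_iff₀ hC] at hy
      exact ⟨hyU, by linarith [hηC (y - x)]⟩
    rw [nhds_prod_eq]
    filter_upwards [key.prod_mk key] with p hp
    calc _ ≤ ε / C * η (p.1 - p.2) := H _ hp.2.1 _ hp.1.1 hp.1.2 hp.2.2
      _ ≤ ε / C * (C * ‖p.1 - p.2‖) := by gcongr; exact hηC _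
      _ = ε * ‖p.1 - p.2‖ := by field_simp
  · intro h γ hγ
    obtain ⟨C, hC, hγC⟩ := hγ.exists_le_mul_norm
    refine ⟨_, isGauge_norm 𝕂, fun ε hε => ?_⟩
    have h' := @h (ε / C) (by positivity)
    obtain ⟨δ, hδ, H⟩ := Metric.eventually_nhds_iff.1 h'
    refine ⟨δ, hδ, fun y _ z _ hz hy => ?_⟩
    have := @H (z, y) (by
      rw [Prod.dist_eq, dist_eq_norm, dist_eq_norm]; exact max_lt hz hy)
    calc _ ≤ C * ‖f z - f y - A (z - y)‖ := hγC _
      _ ≤ C * (ε / C * ‖z - y‖) := by gcongr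
      _ = ε * ‖z - y‖ := by field_simp

end Gauges

/-! ### The three classes treated uniformly, and the chain rule. -/

section Classes

variable {𝕂 : Type u} [NontriviallyNormedField 𝕂]
variable {E : Type u} [NormedAddCommGroup E] [NormedSpace 𝕂 E]
variable {F : Type u} [NormedAddCommGroup F] [NormedSpace 𝕂 F]
variable {G : Type u} [NormedAddCommGroup G] [NormedSpace 𝕂 G]

/-- The regularity that maps of the given kind are required to have at the last level. -/
def DiffKind.last : DiffKind → DiffKind
  | .C => .C
  | .SC => .C
  | .LC => .LC

variable (𝕂) in
/-- The pointwise regularity attached to the three kinds of differentiability: continuity,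
strict differentiability, and Lipschitz continuity on a neighbourhood. -/
def RegAt (c : DiffKind) (f : E → F) (x : E) : Prop :=
  match c with
  | .C => ContinuousAt f x
  | .SC => ∃ A : E →L[𝕂] F, HasStrictFDerivAt f A x
  | .LC => ∃ K : ℝ≥0, ∃ s ∈ 𝓝 x, LipschitzOnWith K f s

theorem RegAt.continuousAt {c : DiffKind} {f : E → F} {x : E} (h : RegAt 𝕂 c f x) :
    ContinuousAt f x := by
  match c, h with
  | .C, h => exact h
  | .SC, ⟨_, h⟩ => exact h.continuousAt
  | .LC, ⟨_, _, hs, h⟩ => exact h.continuousOn.continuousAt hs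

theorem RegAt.last {c : DiffKind} {f : E → F} {x : E} (h : RegAt 𝕂 c f x) :
    RegAt 𝕂 c.last f x := by
  match c, h with
  | .C, h => exact h
  | .SC, h => exact h.continuousAt
  | .LC, h => exact h

theorem RegAt.comp {c : DiffKind} {f : F → G} {g : E → F} {x : E} (hf : RegAt 𝕂 c f (g x))
    (hg : RegAt 𝕂 c g x) : RegAt 𝕂 c (fun y => f (g y)) x := by
  have hgc := hg.continuousAt
  match c, hf, hg with
  | .C, hf, hg => exact ContinuousAt.comp (f := g) hf hg
  | .SC, ⟨_, hf⟩, ⟨_, hg⟩ => exact ⟨_, hf.comp x hg⟩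
  | .LC, ⟨K, s, hs, hf⟩, ⟨L, t, ht, hg⟩ =>
    exact ⟨K * L, t ∩ g ⁻¹' s, inter_mem ht (hgc hs),
      hf.comp (hg.mono inter_subset_left) fun _ hy => hy.2⟩

theorem RegAt.prodMk {c : DiffKind} {f : E → F} {g : E → G} {x : E} (hf : RegAt 𝕂 c f x)
    (hg : RegAt 𝕂 c g x) : RegAt 𝕂 c (fun y => (f y, g y)) x := by
  match c, hf, hg with
  | .C, hf, hg => exact ContinuousAt.prodMk hf hg
  | .SC, ⟨_, hf⟩, ⟨_, hg⟩ => exact ⟨_, hf.prodMk hg⟩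
  | .LC, ⟨K, s, hs, hf⟩, ⟨L, t, ht, hg⟩ =>
    exact ⟨max K L, s ∩ t, inter_mem hs ht,
      (hf.mono inter_subset_left).prodMk (hg.mono inter_subset_right)⟩

theorem regAt_clm (c : DiffKind) (L : E →L[𝕂] F) (x : E) : RegAt 𝕂 c L x := by
  match c with
  | .C => exact L.continuous.continuousAt
  | .SC => exact ⟨L, L.hasStrictFDerivAt⟩
  | .LC => exact ⟨_, univ, univ_mem, L.lipschitz.lipschitzOnWith⟩

variable (𝕂) in
/-- The classes `C^n`, `SC^n` and `LC^n` for maps on open subsets of normed spaces, in terms of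
the pointwise regularity `RegAt`. -/
def Reg (c : DiffKind) : (n : ℕ) → {E : Type u} → [NormedAddCommGroup E] → [NormedSpace 𝕂 E] →
    Set E → (E → F) → Prop
  | 0, _, _, _, U, f => ∀ x ∈ U, RegAt 𝕂 c.last f x
  | n + 1, E, _, _, U, f => (∀ x ∈ U, RegAt 𝕂 c f x) ∧
      ∃ g : E × E × 𝕂 → F, IsExtDiffQuot 𝕂 U f g ∧ Reg c n (dom1 𝕂 U) g

theorem cNat_iff {n : ℕ} {E : Type u} [NormedAddCommGroup E] [NormedSpace 𝕂 E] {U : Set E}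
    (hU : IsOpen U) {f : E → F} : CNat 𝕂 n U f ↔ Reg 𝕂 .C n U f := by
  induction n generalizing E with
  | zero => exact hU.continuousOn_iff
  | succ n ih =>
    exact and_congr hU.continuousOn_iff
      (exists_congr fun g => and_congr_right fun _ => ih (isOpen_dom1 𝕂 hU))

theorem scNat_iff {n : ℕ} {E : Type u} [NormedAddCommGroup E] [NormedSpace 𝕂 E] {U : Set E}
    (hU : IsOpen U) {f : E → F} : SCNat 𝕂 n U f ↔ Reg 𝕂 .SC n U f := by
  induction n generalizing E with
  | zero => exact hU.continuousOn_iff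
  | succ n ih =>
    have hs : StrictDiffOn 𝕂 U f ↔ ∀ x ∈ U, RegAt 𝕂 .SC f x :=
      forall₂_congr fun x hx => strictDiffAt_iff hU hx
    have hr : (∃ g, IsExtDiffQuot 𝕂 U f g ∧ SCNat 𝕂 n (dom1 𝕂 U) g) ↔
        ∃ g, IsExtDiffQuot 𝕂 U f g ∧ Reg 𝕂 .SC n (dom1 𝕂 U) g :=
      exists_congr fun g => and_congr_right fun _ => ih (isOpen_dom1 𝕂 hU)
    constructor
    · exact fun h => ⟨hs.1 h.2.1, hr.1 h.2.2⟩
    · exact fun h => ⟨fun x hx => (h.1 x hx).continuousAt.continuousWithinAt, hs.2 h.1, hr.2 h.2⟩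

theorem lcNat_iff {n : ℕ} {E : Type u} [NormedAddCommGroup E] [NormedSpace 𝕂 E] {U : Set E}
    (hU : IsOpen U) {f : E → F} : LCNat 𝕂 n U f ↔ Reg 𝕂 .LC n U f := by
  have hs {E : Type u} [NormedAddCommGroup E] [NormedSpace 𝕂 E] {U : Set E}
      (hU : IsOpen U) {f : E → F} :
      ContinuousOn f U ∧ LipschitzContOn 𝕂 U f ↔ ∀ x ∈ U, RegAt 𝕂 .LC f x := by
    rw [lipschitzContOn_iff hU]
    exact and_iff_right_of_imp fun h x hx =>
      (RegAt.continuousAt (𝕂 := 𝕂) (c := .LC) (h x hx)).continuousWithinAt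
  induction n generalizing E with
  | zero => exact hs hU
  | succ n ih =>
    have hr : (∃ g, IsExtDiffQuot 𝕂 U f g ∧ LCNat 𝕂 n (dom1 𝕂 U) g) ↔
        ∃ g, IsExtDiffQuot 𝕂 U f g ∧ Reg 𝕂 .LC n (dom1 𝕂 U) g :=
      exists_congr fun g => and_congr_right fun _ => ih (isOpen_dom1 𝕂 hU)
    exact and_assoc.symm.trans (and_congr (hs hU) hr)

theorem ofClass_iff {c : DiffKind} {k : ℕ∞} {U : Set E} (hU : IsOpen U) {f : E → F} :
    OfClass 𝕂 c k U f ↔ ∀ n : ℕ, (n : ℕ∞) ≤ k → Reg 𝕂 c n U f := by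
  refine forall₂_congr fun n _ => ?_
  match c with
  | .C => exact cNat_iff hU
  | .SC => exact scNat_iff hU
  | .LC => exact lcNat_iff hU

theorem Reg.regAt_last {c : DiffKind} {n : ℕ} {U : Set E} {f : E → F} (h : Reg 𝕂 c n U f) :
    ∀ x ∈ U, RegAt 𝕂 c.last f x := by
  cases n with
  | zero => exact h
  | succ n => exact fun x hx => (h.1 x hx).last

theorem Reg.continuousOn {c : DiffKind} {n : ℕ} {U : Set E} {f : E → F} (h : Reg 𝕂 c n U f) :
    ContinuousOn f U :=
  fun x hx => (h.regAt_last x hx).continuousAt.continuousWithinAt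

theorem Reg.of_succ {c : DiffKind} {n : ℕ} {E : Type u} [NormedAddCommGroup E] [NormedSpace 𝕂 E]
    {U : Set E} {f : E → F} (h : Reg 𝕂 c (n + 1) U f) : Reg 𝕂 c n U f := by
  induction n generalizing E with
  | zero => exact h.regAt_last
  | succ n ih =>
    obtain ⟨h0, g, hg, h⟩ := h
    exact ⟨h0, g, hg, ih h⟩

theorem IsExtDiffQuot.mono {U V : Set E} {f : E → F} {g : E × E × 𝕂 → F}
    (h : IsExtDiffQuot 𝕂 U f g) (hV : V ⊆ U) : IsExtDiffQuot 𝕂 V f g where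
  continuousOn := h.continuousOn.mono (dom1_mono 𝕂 hV)
  eq_quot x y t hp ht := h.eq_quot x y t (dom1_mono 𝕂 hV hp) ht

theorem Reg.mono {c : DiffKind} {n : ℕ} {E : Type u} [NormedAddCommGroup E] [NormedSpace 𝕂 E]
    {U V : Set E} {f : E → F} (h : Reg 𝕂 c n U f) (hV : V ⊆ U) : Reg 𝕂 c n V f := by
  induction n generalizing E with
  | zero => exact fun x hx => h x (hV hx)
  | succ n ih =>
    obtain ⟨h0, g, hg, h⟩ := h
    exact ⟨fun x hx => h0 x (hV hx), g, hg.mono hV, ih h (dom1_mono 𝕂 hV)⟩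

/-- The extended difference quotient is `(x, y, t) ↦ L y`, again continuous and linear, so the
induction closes. -/
theorem Reg.clm (c : DiffKind) (n : ℕ) {E : Type u} [NormedAddCommGroup E] [NormedSpace 𝕂 E]
    (U : Set E) (L : E →L[𝕂] F) : Reg 𝕂 c n U L := by
  induction n generalizing E with
  | zero => exact fun x _ => regAt_clm _ L x
  | succ n ih =>
    let L' : E × E × 𝕂 →L[𝕂] F :=
      L.comp ((ContinuousLinearMap.fst 𝕂 E 𝕂).comp (ContinuousLinearMap.snd 𝕂 E (E × 𝕂)))
    refine ⟨fun x _ => regAt_clm _ L x, L', ⟨L'.continuous.continuousOn, ?_⟩, ih _ L'⟩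
    intro x y t _ ht
    simp [L', smul_smul, inv_mul_cancel₀ ht]

theorem Reg.prodMk {c : DiffKind} {n : ℕ} {E : Type u} [NormedAddCommGroup E] [NormedSpace 𝕂 E]
    {U : Set E} {f : E → F} {g : E → G} (hf : Reg 𝕂 c n U f) (hg : Reg 𝕂 c n U g) :
    Reg 𝕂 c n U (fun x => (f x, g x)) := by
  induction n generalizing E with
  | zero => exact fun x hx => (hf x hx).prodMk (hg x hx)
  | succ n ih =>
    obtain ⟨hf0, f', hf', hf⟩ := hf
    obtain ⟨hg0, g', hg', hg⟩ := hg
    refine ⟨fun x hx => (hf0 x hx).prodMk (hg0 x hx), fun p => (f' p, g' p),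
      ⟨hf'.continuousOn.prodMk hg'.continuousOn, fun x y t hp ht => ?_⟩, ih hf hg⟩
    simp [hf'.eq_quot x y t hp ht, hg'.eq_quot x y t hp ht]

/-- Chain rule: `(f ∘ g)^[1] (x, y, t) = f^[1] (g x, g^[1] (x, y, t), t)`, a composition of maps of
one order less. -/
theorem Reg.comp {c : DiffKind} {n : ℕ} {E F G : Type u}
    [NormedAddCommGroup E] [NormedSpace 𝕂 E] [NormedAddCommGroup F] [NormedSpace 𝕂 F]
    [NormedAddCommGroup G] [NormedSpace 𝕂 G] {U : Set E} {V : Set F} {f : F → G} {g : E → F}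
    (hf : Reg 𝕂 c n V f) (hg : Reg 𝕂 c n U g) (hUV : MapsTo g U V) :
    Reg 𝕂 c n U (fun x => f (g x)) := by
  induction n generalizing E F G with
  | zero => exact fun x hx => (hf _ (hUV hx)).comp (hg x hx)
  | succ n ih =>
    have hgn := hg.of_succ
    obtain ⟨hf0, f', hf', hf⟩ := hf
    obtain ⟨hg0, g', hg', hg⟩ := hg
    have hπ : Reg 𝕂 c n (dom1 𝕂 U) (fun p => g p.1) :=
      ih hgn (Reg.clm c n (dom1 𝕂 U) (ContinuousLinearMap.fst 𝕂 E (E × 𝕂))) fun p hp => hp.1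
    have ht : Reg 𝕂 c n (dom1 𝕂 U) (fun p => p.2.2) :=
      Reg.clm c n _ ((ContinuousLinearMap.snd 𝕂 E 𝕂).comp (ContinuousLinearMap.snd 𝕂 E (E × 𝕂)))
    have hadd : ∀ x y t, (x, y, t) ∈ dom1 𝕂 U → g x + t • g' (x, y, t) ∈ V := by
      intro x y t hp
      rcases eq_or_ne t 0 with rfl | ht
      · simpa using hUV hp.1
      · rw [hg'.eq_quot x y t hp ht, smul_smul, mul_inv_cancel₀ ht, one_smul, add_sub_cancel]
        exact hUV hp.2
    have hmap : MapsTo (fun p : E × E × 𝕂 => (g p.1, g' p, p.2.2)) (dom1 𝕂 U) (dom1 𝕂 V) :=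
      fun p hp => ⟨hUV hp.1, hadd _ _ _ hp⟩
    have hcomp := ih hf (hπ.prodMk (hg.prodMk ht)) hmap
    refine ⟨fun x hx => (hf0 _ (hUV hx)).comp (hg0 x hx), _, ⟨hcomp.continuousOn, ?_⟩, hcomp⟩
    intro x y t hp ht
    have := hf'.eq_quot _ _ _ (hmap hp) ht
    dsimp only at this ⊢
    rw [this, hg'.eq_quot x y t hp ht, smul_smul, mul_inv_cancel₀ ht, one_smul, add_sub_cancel]

end Classes

/-! ### Regular dependence of fixed points on parameters. -/

section FixedPoints

variable {𝕂 : Type u} [NontriviallyNormedField 𝕂]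
variable {P : Type u} [NormedAddCommGroup P] [NormedSpace 𝕂 P]
variable {E : Type u} [NormedAddCommGroup E] [NormedSpace 𝕂 E]
variable {F : Type u} [NormedAddCommGroup F] [NormedSpace 𝕂 F]

theorem IsExtDiffQuot.tendsto_quot {U : Set E} (hU : IsOpen U) {f : E → F} {g : E × E × 𝕂 → F}
    (hg : IsExtDiffQuot 𝕂 U f g) {x : E} (hx : x ∈ U) (y : E) :
    Tendsto (fun t : 𝕂 => t⁻¹ • (f (x + t • y) - f x)) (𝓝[≠] 0) (𝓝 (g (x, y, 0))) := by
  have hmem : (x, y, (0 : 𝕂)) ∈ dom1 𝕂 U := ⟨hx, by simpa using hx⟩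
  have hD := (isOpen_dom1 𝕂 hU).mem_nhds hmem
  have hc : Tendsto (fun t : 𝕂 => (x, y, t)) (𝓝[≠] 0) (𝓝 (x, y, 0)) :=
    (Continuous.tendsto' (by fun_prop) _ _ rfl).mono_left nhdsWithin_le_nhds
  refine ((hg.continuousOn.continuousAt hD).tendsto.comp hc).congr' ?_
  filter_upwards [hc hD, self_mem_nhdsWithin] with t ht ht0
  exact hg.eq_quot x y t ht ht0

/-- `F` is a contraction with constant `θ` in its second argument. -/
def UnifContr {P : Type u} (θ : ℝ≥0) (Ω : Set (P × E)) (F : P × E → E) : Prop :=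
  ∀ p u v, (p, u) ∈ Ω → (p, v) ∈ Ω → ‖F (p, u) - F (p, v)‖ ≤ θ * ‖u - v‖

variable {θ : ℝ≥0} {Ω : Set (P × E)} {F : P × E → E} {φ : P → E}

/-- Split `φ p - φ q` at `F (p, φ q)`: the first piece is at most `θ * ‖φ p - φ q‖` and is absorbed
on the left. Only the variation of `F` in the parameter remains. -/
theorem UnifContr.norm_sub_le {P : Type u} {Ω : Set (P × E)} {F : P × E → E} {φ : P → E}
    (hF : UnifContr θ Ω F) (hθ : θ < 1) {p q : P}
    (hp : (p, φ p) ∈ Ω) (hpq : (p, φ q) ∈ Ω) (hfp : F (p, φ p) = φ p) (hfq : F (q, φ q) = φ q) :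
    ‖φ p - φ q‖ ≤ (1 - θ : ℝ)⁻¹ * ‖F (p, φ q) - F (q, φ q)‖ := by
  have h1 := hF p _ _ hp hpq
  have hθ' : (0 : ℝ) < 1 - θ := sub_pos.2 (by exact_mod_cast hθ)
  rw [inv_mul_eq_div, le_div_iff₀ hθ']
  have h2 : ‖φ p - φ q‖ ≤ ‖F (p, φ p) - F (p, φ q)‖ + ‖F (p, φ q) - F (q, φ q)‖ := by
    calc ‖φ p - φ q‖ = ‖(F (p, φ p) - F (p, φ q)) + (F (p, φ q) - F (q, φ q))‖ := by
          rw [hfp, hfq]; congr 1; abel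
      _ ≤ _ := norm_add_le _ _
  linarith

theorem UnifContr.continuousAt (hF : UnifContr θ Ω F) (hθ : θ < 1) (hΩ : IsOpen Ω) {p : P}
    (hφ : ∀ᶠ q in 𝓝 p, (q, φ q) ∈ Ω ∧ F (q, φ q) = φ q) (hc : ContinuousAt F (p, φ p)) :
    ContinuousAt φ p := by
  have hp := hφ.self_of_nhds
  have hm : Tendsto (fun q : P => (q, φ p)) (𝓝 p) (𝓝 (p, φ p)) :=
    Continuous.tendsto' (by fun_prop) _ _ rfl
  have hlim : Tendsto (fun q => (1 - θ : ℝ)⁻¹ * ‖F (q, φ p) - F (p, φ p)‖) (𝓝 p) (𝓝 0) := by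
    have := (((hc.tendsto.comp hm).sub_const (F (p, φ p))).norm).const_mul (1 - θ : ℝ)⁻¹
    simpa using this
  refine tendsto_iff_norm_sub_tendsto_zero.2 (squeeze_zero' (Eventually.of_forall fun _ =>
    norm_nonneg _) ?_ hlim)
  filter_upwards [hφ, hm (hΩ.mem_nhds hp.1)] with q hq hqp
  exact hF.norm_sub_le hθ hq.1 hqp hq.2 hp.2

theorem UnifContr.exists_lipschitzOnWith (hF : UnifContr θ Ω F) (hθ : θ < 1) (hΩ : IsOpen Ω)
    {p : P} (hφ : ∀ᶠ q in 𝓝 p, (q, φ q) ∈ Ω ∧ F (q, φ q) = φ q) {K : ℝ≥0} {s : Set (P × E)}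
    (hs : s ∈ 𝓝 (p, φ p)) (hK : LipschitzOnWith K F s) :
    ∃ L : ℝ≥0, ∃ t ∈ 𝓝 p, LipschitzOnWith L φ t := by
  have hc := hF.continuousAt hθ hΩ hφ (hK.continuousOn.continuousAt hs)
  have hp := hφ.self_of_nhds
  -- The estimate evaluates `F` at mixed points `(q, φ r)`; continuity of `φ` keeps them in `Ω ∩ s`.
  have hev : ∀ᶠ r : P × P in 𝓝 p ×ˢ 𝓝 p, (r.1, φ r.2) ∈ Ω ∩ s := by
    have : Tendsto (fun r : P × P => (r.1, φ r.2)) (𝓝 p ×ˢ 𝓝 p) (𝓝 (p, φ p)) := by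
      rw [nhds_prod_eq]
      exact tendsto_id.prodMap hc
    exact this (inter_mem (hΩ.mem_nhds hp.1) hs)
  obtain ⟨t, ht, hts⟩ := mem_prod_self_iff.1 hev
  have hθ' : (0 : ℝ) < 1 - θ := sub_pos.2 (by exact_mod_cast hθ)
  refine ⟨(1 - θ : ℝ)⁻¹.toNNReal * K, t ∩ {q | (q, φ q) ∈ Ω ∧ F (q, φ q) = φ q},
    inter_mem ht hφ, LipschitzOnWith.of_dist_le_mul fun q hq r hr => ?_⟩
  have h1 := hts (mk_mem_prod hq.1 hr.1)
  have h2 := hts (mk_mem_prod hr.1 hr.1)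
  rw [dist_eq_norm, dist_eq_norm, NNReal.coe_mul, Real.coe_toNNReal _ (by positivity), mul_assoc]
  refine (hF.norm_sub_le hθ hq.2.1 h1.1 hq.2.2 hr.2.2).trans ?_
  gcongr
  refine (hK.norm_sub_le h1.2 h2.2).trans (le_of_eq ?_)
  simp [Prod.norm_def]

/-- Linearising the fixed point equation gives `(1 - A₂) Δφ = A₁ Δp + o(Δp, Δφ)`. The error is
`o(Δp)` because `φ` is Lipschitz near `p`, and `1 - A₂` is invertible by the Neumann series since
`‖A₂‖ ≤ θ < 1`. -/
theorem UnifContr.exists_hasStrictFDerivAt [CompleteSpace E] (hF : UnifContr θ Ω F) (hθ : θ < 1)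
    (hΩ : IsOpen Ω) {p : P} (hφ : ∀ᶠ q in 𝓝 p, (q, φ q) ∈ Ω ∧ F (q, φ q) = φ q)
    {T : P × E →L[𝕂] E} (hT : HasStrictFDerivAt F T (p, φ p)) :
    ∃ B : P →L[𝕂] E, HasStrictFDerivAt φ B p := by
  obtain ⟨K, s, hs, hK⟩ := hT.exists_lipschitzOnWith
  obtain ⟨L, t, ht, hL⟩ := hF.exists_lipschitzOnWith hθ hΩ hφ hs hK
  have hc : ContinuousAt φ p := hL.continuousOn.continuousAt ht
  have hp := hφ.self_of_nhds
  let A₁ : P →L[𝕂] E := T.comp (ContinuousLinearMap.inl 𝕂 P E)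
  let A₂ : E →L[𝕂] E := T.comp (ContinuousLinearMap.inr 𝕂 P E)
  have hA₂ : ‖A₂‖ < 1 := by
    have hd : HasFDerivAt (fun u => F (p, u)) A₂ (φ p) :=
      hT.hasFDerivAt.comp (φ p) (hasFDerivAt_prodMk_right p (φ p))
    have hm : Tendsto (fun u : E => (p, u)) (𝓝 (φ p)) (𝓝 (p, φ p)) :=
      Continuous.tendsto' (by fun_prop) _ _ rfl
    refine (hd.le_of_lip' θ.coe_nonneg ?_).trans_lt (by exact_mod_cast hθ)
    filter_upwards [hm (hΩ.mem_nhds hp.1)] with u hu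
    exact hF p _ _ hu hp.1
  obtain ⟨S, hS⟩ := isUnit_one_sub_of_norm_lt_one hA₂
  have hSi : ∀ v, (↑S⁻¹ : E →L[𝕂] E) (v - A₂ v) = v := fun v => by
    have : (↑S⁻¹ * ↑S : E →L[𝕂] E) v = v := by rw [S.inv_mul]; rfl
    rwa [hS] at this
  refine ⟨(↑S⁻¹ : E →L[𝕂] E).comp A₁, ?_⟩
  rw [hasStrictFDerivAt_iff_isLittleO]
  have hm : Tendsto (fun r : P × P => ((r.1, φ r.1), (r.2, φ r.2))) (𝓝 (p, p))
      (𝓝 ((p, φ p), (p, φ p))) := by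
    have : Tendsto (fun q => (q, φ q)) (𝓝 p) (𝓝 (p, φ p)) :=
      (tendsto_id (x := 𝓝 p)).prodMk_nhds hc
    rw [nhds_prod_eq, nhds_prod_eq (x := (p, φ p))]
    exact this.prodMap this
  have hO : (fun r : P × P => (r.1, φ r.1) - (r.2, φ r.2)) =O[𝓝 (p, p)]
      fun r => r.1 - r.2 := by
    refine (isBigO_refl _ _).prod_left (IsBigO.of_bound L ?_)
    rw [nhds_prod_eq]
    filter_upwards [prod_mem_prod ht ht] with r hr
    exact hL.norm_sub_le hr.1 hr.2
  have ho := ((hasStrictFDerivAt_iff_isLittleO.1 hT).comp_tendsto hm).trans_isBigO hO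
  refine (((↑S⁻¹ : E →L[𝕂] E).isBigO_comp _ _).trans_isLittleO ho).congr' ?_ EventuallyEq.rfl
  rw [nhds_prod_eq]
  filter_upwards [hφ.prod_mk hφ] with r hr
  have hlin : T ((r.1, φ r.1) - (r.2, φ r.2)) = A₁ (r.1 - r.2) + A₂ (φ r.1 - φ r.2) := by
    simp only [A₁, A₂, ContinuousLinearMap.comp_apply, ContinuousLinearMap.inl_apply,
      ContinuousLinearMap.inr_apply, ← map_add]
    simp
  simp only [Function.comp_apply]
  rw [hlin, hr.1.2, hr.2.2, ← sub_sub, sub_right_comm, map_sub, hSi]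
  rfl

theorem UnifContr.regAt [CompleteSpace E] {c : DiffKind} (hF : UnifContr θ Ω F) (hθ : θ < 1)
    (hΩ : IsOpen Ω) {p : P} (hφ : ∀ᶠ q in 𝓝 p, (q, φ q) ∈ Ω ∧ F (q, φ q) = φ q)
    (h : RegAt 𝕂 c F (p, φ p)) : RegAt 𝕂 c φ p := by
  match c, h with
  | .C, h => exact hF.continuousAt hθ hΩ hφ h
  | .SC, ⟨_, h⟩ => exact hF.exists_hasStrictFDerivAt hθ hΩ hφ h
  | .LC, ⟨_, _, hs, h⟩ => exact hF.exists_lipschitzOnWith hθ hΩ hφ hs h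

/-- The extended difference quotient map of a uniform family of contractions is again a uniform
family of contractions, in the direction of the contracting variable. -/
theorem UnifContr.extDiffQuot (hF : UnifContr θ Ω F) (hΩ : IsOpen Ω)
    {F' : (P × E) × (P × E) × 𝕂 → E} (hF' : IsExtDiffQuot 𝕂 Ω F F') {p q : P} {u w₁ w₂ : E}
    {t : 𝕂} (h₁ : ((p, u), (q, w₁), t) ∈ dom1 𝕂 Ω) (h₂ : ((p, u), (q, w₂), t) ∈ dom1 𝕂 Ω) :
    ‖F' ((p, u), (q, w₁), t) - F' ((p, u), (q, w₂), t)‖ ≤ θ * ‖w₁ - w₂‖ := by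
  -- The base value `F (p, u)` cancels, and both remaining terms share the parameter `p + t • q`;
  -- the factors `‖t‖` and `‖t‖⁻¹` then cancel. The case `t = 0` follows by passing to the limit.
  have key : ∀ t : 𝕂, t ≠ 0 → (p, u) + t • (q, w₁) ∈ Ω → (p, u) + t • (q, w₂) ∈ Ω →
      ‖t⁻¹ • (F ((p, u) + t • (q, w₁)) - F (p, u)) -
        t⁻¹ • (F ((p, u) + t • (q, w₂)) - F (p, u))‖ ≤ θ * ‖w₁ - w₂‖ := by
    intro t ht h₁ h₂
    have := hF (p + t • q) (u + t • w₁) (u + t • w₂) h₁ h₂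
    rw [add_sub_add_left_eq_sub, ← smul_sub, norm_smul] at this
    rw [← smul_sub, sub_sub_sub_cancel_right, norm_smul, norm_inv,
      inv_mul_le_iff₀ (norm_pos_iff.2 ht)]
    calc _ ≤ _ := this
      _ = _ := by ring
  rcases eq_or_ne t 0 with rfl | ht
  · have hev : ∀ w, ∀ᶠ t : 𝕂 in 𝓝[≠] 0, (p, u) + t • (q, w) ∈ Ω := fun w => by
      have : Tendsto (fun t : 𝕂 => (p, u) + t • (q, w)) (𝓝[≠] 0) (𝓝 (p, u)) :=
        (Continuous.tendsto' (by fun_prop) _ _ (by simp)).mono_left nhdsWithin_le_nhds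
      exact this (hΩ.mem_nhds h₁.1)
    refine le_of_tendsto ((hF'.tendsto_quot hΩ h₁.1 (q, w₁)).sub
      (hF'.tendsto_quot hΩ h₁.1 (q, w₂))).norm ?_
    filter_upwards [hev w₁, hev w₂, self_mem_nhdsWithin] with t h₁ h₂ ht
    exact key t ht h₁ h₂
  · rw [hF'.eq_quot _ _ _ h₁ ht, hF'.eq_quot _ _ _ h₂ ht]
    exact key t ht h₁.2 h₂.2

/-- The fixed points of a uniform family of contractions depend on the parameter as regularly as
the family does. -/
theorem Reg.fixedPoint [CompleteSpace E] {c : DiffKind} {n : ℕ} {P : Type u}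
    [NormedAddCommGroup P] [NormedSpace 𝕂 P] {P₀ : Set P} {Ω : Set (P × E)} {F : P × E → E}
    {φ : P → E} (hθ : θ < 1) (hP₀ : IsOpen P₀) (hΩ : IsOpen Ω) (hF : UnifContr θ Ω F)
    (hφΩ : ∀ p ∈ P₀, (p, φ p) ∈ Ω) (hφ : ∀ p ∈ P₀, F (p, φ p) = φ p) (h : Reg 𝕂 c n Ω F) :
    Reg 𝕂 c n P₀ φ := by
  induction n generalizing P with
  | zero =>
    intro p hp
    refine hF.regAt hθ hΩ ?_ (h _ (hφΩ p hp))
    filter_upwards [hP₀.mem_nhds hp] with q hq using ⟨hφΩ q hq, hφ q hq⟩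
  | succ n ih =>
    -- The family defining `φ^[1]` involves `φ` itself, so `φ` is first needed at order `n`.
    have hφn := ih hP₀ hΩ hF hφΩ hφ h.of_succ
    obtain ⟨h0, F', hF', h⟩ := h
    have hmem0 : ∀ p q w, p ∈ P₀ → ((p, φ p), (q, w), (0 : 𝕂)) ∈ dom1 𝕂 Ω :=
      fun p q w hp => ⟨hφΩ p hp, by simpa using hφΩ p hp⟩
    -- At `t = 0` the domain imposes no condition on `w`, so Banach's theorem on all of `E` supplies
    -- the candidate for `φ^[1] (p, q, 0)`.
    have hex : ∀ p q, p ∈ P₀ → ∃ w, F' ((p, φ p), (q, w), (0 : 𝕂)) = w := by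
      intro p q hp
      have hcw : ContractingWith θ (fun w => F' ((p, φ p), (q, w), (0 : 𝕂))) := by
        refine ⟨hθ, LipschitzWith.of_dist_le_mul fun w₁ w₂ => ?_⟩
        rw [dist_eq_norm, dist_eq_norm]
        exact hF.extDiffQuot hΩ hF' (hmem0 p q w₁ hp) (hmem0 p q w₂ hp)
      exact ⟨_, hcw.fixedPoint_isFixedPt⟩
    classical
    choose ψ hψ using hex
    let φ' : P × P × 𝕂 → E := fun r =>
      if r.2.2 = 0 then if hr : r.1 ∈ P₀ then ψ r.1 r.2.1 hr else 0
      else r.2.2⁻¹ • (φ (r.1 + r.2.2 • r.2.1) - φ r.1)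
    have hφ'Ω : ∀ r ∈ dom1 𝕂 P₀, ((r.1, φ r.1), (r.2.1, φ' r), r.2.2) ∈ dom1 𝕂 Ω := by
      rintro ⟨p, q, t⟩ hr
      refine ⟨hφΩ p hr.1, ?_⟩
      rcases eq_or_ne t 0 with rfl | ht
      · simpa using hφΩ p hr.1
      · have := hφΩ _ hr.2
        simpa [φ', ht, smul_smul] using this
    have hφ'fix : ∀ r ∈ dom1 𝕂 P₀, F' ((r.1, φ r.1), (r.2.1, φ' r), r.2.2) = φ' r := by
      rintro ⟨p, q, t⟩ hr
      rcases eq_or_ne t 0 with rfl | ht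
      · have hp : p ∈ P₀ := hr.1
        simpa [φ', hp] using hψ p q hp
      · rw [hF'.eq_quot _ _ _ (hφ'Ω _ hr) ht]
        have h1 : F (p + t • q, φ (p + t • q)) = φ (p + t • q) := hφ _ hr.2
        have h2 : F (p, φ p) = φ p := hφ _ hr.1
        simp [φ', ht, smul_smul, h1, h2]
    let Ψ : (P × P × 𝕂) × E → (P × E) × (P × E) × 𝕂 :=
      fun z => ((z.1.1, φ z.1.1), (z.1.2.1, z.2), z.1.2.2)
    let D : Set ((P × P × 𝕂) × E) := dom1 𝕂 P₀ ×ˢ univ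
    have hD : IsOpen D := (isOpen_dom1 𝕂 hP₀).prod isOpen_univ
    have hΨ : Reg 𝕂 c n D Ψ := by
      let π₁ : (P × P × 𝕂) × E →L[𝕂] P × P × 𝕂 := ContinuousLinearMap.fst _ _ _
      let π₂ : P × P × 𝕂 →L[𝕂] P × 𝕂 := ContinuousLinearMap.snd _ _ _
      let a : (P × P × 𝕂) × E →L[𝕂] P := (ContinuousLinearMap.fst _ _ _).comp π₁
      let b : (P × P × 𝕂) × E →L[𝕂] P := (ContinuousLinearMap.fst _ _ _).comp (π₂.comp π₁)
      let d : (P × P × 𝕂) × E →L[𝕂] 𝕂 := (ContinuousLinearMap.snd _ _ _).comp (π₂.comp π₁)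
      let e : (P × P × 𝕂) × E →L[𝕂] E := ContinuousLinearMap.snd _ _ _
      have ha : Reg 𝕂 c n D (fun z => φ (a z)) := hφn.comp (Reg.clm c n D a) fun z hz => hz.1.1
      exact ((Reg.clm c n D a).prodMk ha).prodMk
        (((Reg.clm c n D b).prodMk (Reg.clm c n D e)).prodMk
          (Reg.clm c n D d))
    have hΩ' : IsOpen (D ∩ Ψ ⁻¹' dom1 𝕂 Ω) :=
      hΨ.continuousOn.isOpen_inter_preimage hD (isOpen_dom1 𝕂 hΩ)
    have hcontr : UnifContr θ (D ∩ Ψ ⁻¹' dom1 𝕂 Ω) (fun z => F' (Ψ z)) :=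
      fun r w₁ w₂ h₁ h₂ => hF.extDiffQuot hΩ hF' h₁.2 h₂.2
    -- The induction hypothesis, with parameter space `P × P × 𝕂`, also yields the continuity of
    -- `φ'` across `t = 0`, which makes it an extended difference quotient.
    have hreg : Reg 𝕂 c n (dom1 𝕂 P₀) φ' :=
      ih (isOpen_dom1 𝕂 hP₀) hΩ' hcontr (fun r hr => ⟨⟨hr, mem_univ _⟩, hφ'Ω r hr⟩) hφ'fix
        (h.comp (hΨ.mono inter_subset_left) fun z hz => hz.2)
    refine ⟨fun p hp => ?_, φ', ⟨hreg.continuousOn, fun p q t _ ht => if_neg ht⟩, hreg⟩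
    refine hF.regAt hθ hΩ ?_ (h0 _ (hφΩ p hp))
    filter_upwards [hP₀.mem_nhds hp] with q hq using ⟨hφΩ q hq, hφ q hq⟩

end FixedPoints

/-! ### Strict differentiability from each of the alternative hypotheses. -/

section StrictDifferentiability

variable {𝕂 : Type u} [NontriviallyNormedField 𝕂]
variable {E : Type u} [NormedAddCommGroup E] [NormedSpace 𝕂 E]
variable {F : Type u} [NormedAddCommGroup F] [NormedSpace 𝕂 F]
variable {U : Set E} {f : E → F} {g : E × E × 𝕂 → F} {x : E} {A : E →L[𝕂] F}

/-- If `f^[1] - A ∘ pr₂` is bounded by `M` on a neighbourhood of `{x} × ball 0 r × {0}`, then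
`f - A` is Lipschitz near `x`, with constant `r⁻¹ ‖c‖ M` for any scalar `c` with `1 < ‖c‖`. -/
theorem IsExtDiffQuot.eventually_norm_sub_le (hU : IsOpen U) (hg : IsExtDiffQuot 𝕂 U f g)
    (hx : x ∈ U) (A : E →L[𝕂] F) {c : 𝕂} (hc : 1 < ‖c‖) {r M : ℝ} (hr : 0 < r)
    (h : ∃ δ > 0, ∀ z y t, ‖z - x‖ < δ → ‖y‖ < r → ‖t‖ < δ → (z, y, t) ∈ dom1 𝕂 U →
      ‖g (z, y, t) - A y‖ ≤ M) :
    ∀ᶠ p : E × E in 𝓝 (x, x),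
      ‖f p.1 - f p.2 - A (p.1 - p.2)‖ ≤ r⁻¹ * ‖c‖ * M * ‖p.1 - p.2‖ := by
  obtain ⟨δ, hδ, h⟩ := h
  have hc0 : 0 < ‖c‖ := one_pos.trans hc
  have hev : ∀ᶠ p : E × E in 𝓝 (x, x), r⁻¹ * ‖c‖ * ‖p.1 - p.2‖ < δ := by
    have : Tendsto (fun p : E × E => r⁻¹ * ‖c‖ * ‖p.1 - p.2‖) (𝓝 (x, x)) (𝓝 0) :=
      Continuous.tendsto' (by fun_prop) _ _ (by simp)
    exact this.eventually_lt_const hδ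
  have hev₂ : ∀ᶠ p : E × E in 𝓝 (x, x), ‖p.2 - x‖ < δ := by
    have : Tendsto (fun p : E × E => ‖p.2 - x‖) (𝓝 (x, x)) (𝓝 0) :=
      Continuous.tendsto' (by fun_prop) _ _ (by simp)
    exact this.eventually_lt_const hδ
  have hevU : ∀ᶠ p : E × E in 𝓝 (x, x), p.1 ∈ U ∧ p.2 ∈ U :=
    (hU.prod hU).mem_nhds ⟨hx, hx⟩
  filter_upwards [hev, hev₂, hevU] with p h₁ h₂ hpU
  rcases eq_or_ne p.1 p.2 with heq | hne
  · simp [heq]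
  -- The increment is written as `d⁻¹ • y` with `y = d • (p.1 - p.2)` in the `r`-ball, and `‖d⁻¹‖ ≤
  -- r⁻¹ * ‖c‖ * ‖p.1 - p.2‖` yields the constant.
  obtain ⟨d, hd, hdx, -, hle⟩ := rescale_to_shell hc hr (sub_ne_zero.2 hne)
  have hsm : d⁻¹ • d • (p.1 - p.2) = p.1 - p.2 := inv_smul_smul₀ hd _
  have hdom : (p.2, d • (p.1 - p.2), d⁻¹) ∈ dom1 𝕂 U := by
    refine ⟨hpU.2, ?_⟩
    change p.2 + d⁻¹ • d • (p.1 - p.2) ∈ U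
    rw [hsm, add_sub_cancel]
    exact hpU.1
  have hq := h _ _ _ h₂ hdx (by rw [norm_inv]; exact hle.trans_lt h₁) hdom
  rw [hg.eq_quot _ _ _ hdom (inv_ne_zero hd), hsm, add_sub_cancel, inv_inv, map_smul,
    ← smul_sub, norm_smul] at hq
  have hd' : 0 < ‖d‖ := norm_pos_iff.2 hd
  calc ‖f p.1 - f p.2 - A (p.1 - p.2)‖
      = ‖d‖⁻¹ * (‖d‖ * ‖f p.1 - f p.2 - A (p.1 - p.2)‖) := by field_simp
    _ ≤ (r⁻¹ * ‖c‖ * ‖p.1 - p.2‖) * M := by gcongr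
    _ = _ := by ring

/-- The radius `r` for `y` stays fixed while `z` and `t` shrink. This uniformity in `y` is more than
continuity of `g` provides in infinite dimension. -/
theorem IsExtDiffQuot.hasStrictFDerivAt (hU : IsOpen U) (hg : IsExtDiffQuot 𝕂 U f g) (hx : x ∈ U)
    {r : ℝ} (hr : 0 < r)
    (h : ∀ ε > 0, ∃ δ > 0, ∀ z y t, ‖z - x‖ < δ → ‖y‖ < r → ‖t‖ < δ → (z, y, t) ∈ dom1 𝕂 U →
      ‖g (z, y, t) - A y‖ ≤ ε) :
    HasStrictFDerivAt f A x := by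
  obtain ⟨c, hc⟩ := NormedField.exists_one_lt_norm 𝕂
  have hc0 : 0 < ‖c‖ := one_pos.trans hc
  rw [hasStrictFDerivAt_iff_isLittleO, isLittleO_iff]
  intro ε hε
  have hε' : 0 < r * ‖c‖⁻¹ * ε := by positivity
  filter_upwards [hg.eventually_norm_sub_le hU hx A hc hr (h _ hε')] with p hp
  refine hp.trans (le_of_eq ?_)
  field_simp

/-- A `C^1`-map between normed spaces is locally Lipschitz. -/
theorem IsExtDiffQuot.exists_lipschitzOnWith (hU : IsOpen U) (hg : IsExtDiffQuot 𝕂 U f g)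
    (hx : x ∈ U) : ∃ K : ℝ≥0, ∃ s ∈ 𝓝 x, LipschitzOnWith K f s := by
  obtain ⟨c, hc⟩ := NormedField.exists_one_lt_norm 𝕂
  have hmem : (x, (0 : E), (0 : 𝕂)) ∈ dom1 𝕂 U := ⟨hx, by simpa using hx⟩
  have hgc := hg.continuousOn.continuousAt ((isOpen_dom1 𝕂 hU).mem_nhds hmem)
  set M : ℝ := ‖g (x, 0, 0)‖ + 1
  have hM : 0 ≤ M := by positivity
  obtain ⟨δ, hδ, hball⟩ := Metric.eventually_nhds_iff.1
    (hgc.norm.eventually_lt_const (lt_add_one _))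
  have hev := hg.eventually_norm_sub_le hU hx 0 hc hδ ⟨δ, hδ, fun z y t hz hy ht _ => by
    have : ‖g (z, y, t)‖ < M := @hball (z, y, t) (by
      simp only [dist_eq_norm, Prod.mk_sub_mk, Prod.norm_mk, sub_zero]
      exact max_lt hz (max_lt hy ht))
    simpa using this.le⟩
  rw [nhds_prod_eq] at hev
  obtain ⟨s, hs, hss⟩ := mem_prod_self_iff.1 hev
  refine ⟨(δ⁻¹ * ‖c‖ * M).toNNReal, s, hs, LipschitzOnWith.of_dist_le_mul fun y hy z hz => ?_⟩
  rw [dist_eq_norm, dist_eq_norm, Real.coe_toNNReal _ (by positivity)]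
  simpa using hss (mk_mem_prod hy hz)

/-- The Lipschitz bound compares `g (z, y, t)` with `g (x, y, 0) = A y`, uniformly for `y` in a
fixed ball. -/
theorem IsExtDiffQuot.hasStrictFDerivAt_of_lipschitz (hU : IsOpen U)
    (hg : IsExtDiffQuot 𝕂 U f g) (hx : x ∈ U) (hA : ∀ y, g (x, y, 0) = A y) {K : ℝ≥0}
    {s : Set (E × E × 𝕂)} (hs : s ∈ 𝓝 (x, 0, 0)) (hK : LipschitzOnWith K g s) :
    HasStrictFDerivAt f A x := by
  obtain ⟨r, hr, hball⟩ := Metric.mem_nhds_iff.1 hs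
  refine hg.hasStrictFDerivAt hU hx hr fun ε hε => ⟨min r (ε / (K + 1)), by positivity, ?_⟩
  intro z y t hz hy ht _
  have h1 : (z, y, t) ∈ s := hball (by
    simp only [mem_ball_iff_norm, Prod.mk_sub_mk, Prod.norm_mk, sub_zero]
    exact max_lt (hz.trans_le (min_le_left _ _)) (max_lt hy (ht.trans_le (min_le_left _ _))))
  have h2 : (x, y, (0 : 𝕂)) ∈ s := hball (by
    simp only [mem_ball_iff_norm, Prod.mk_sub_mk, Prod.norm_mk, sub_zero, sub_self, norm_zero]
    exact max_lt hr (max_lt hy hr))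
  have h3 : ‖(z, y, t) - (x, y, 0)‖ ≤ ε / (K + 1) := by
    simp only [Prod.mk_sub_mk, Prod.norm_mk, sub_self, norm_zero, sub_zero]
    exact max_le (hz.trans_le (min_le_right _ _)).le
      (max_le (by positivity) (ht.trans_le (min_le_right _ _)).le)
  rw [← hA]
  calc _ ≤ K * ‖(z, y, t) - (x, y, 0)‖ := hK.norm_sub_le h1 h2
    _ ≤ (K + 1) * (ε / (K + 1)) := by gcongr; exact le_add_of_nonneg_right zero_le_one
    _ = ε := by field_simp

/-- Here uniformity in `y` comes from compactness of the closed unit ball, by the tube lemma. -/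
theorem IsExtDiffQuot.hasStrictFDerivAt_of_properSpace [ProperSpace E] (hU : IsOpen U)
    (hg : IsExtDiffQuot 𝕂 U f g) (hx : x ∈ U) (hA : ∀ y, g (x, y, 0) = A y) :
    HasStrictFDerivAt f A x := by
  refine hg.hasStrictFDerivAt hU hx one_pos fun ε hε => ?_
  have hD := isOpen_dom1 𝕂 hU
  let N : Set (E × E × 𝕂) := dom1 𝕂 U ∩ (fun p => g p - A p.2.1) ⁻¹' Metric.ball 0 ε
  have hN : IsOpen N :=
    (hg.continuousOn.sub (by fun_prop)).isOpen_inter_preimage hD Metric.isOpen_ball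
  let N' : Set (E × E × 𝕂) := (fun p => (p.2.1, p.1, p.2.2)) ⁻¹' N
  have hN' : IsOpen N' := hN.preimage (by fun_prop)
  have hsub : Metric.closedBall (0 : E) 1 ×ˢ {(x, (0 : 𝕂))} ⊆ N' := by
    rintro ⟨y, p⟩ ⟨-, rfl⟩
    exact ⟨⟨hx, by simpa using hx⟩, by simpa [hA] using hε⟩
  obtain ⟨u, v, -, hv, hu, hxv, huv⟩ :=
    generalized_tube_lemma (isCompact_closedBall _ _) isCompact_singleton hN' hsub
  obtain ⟨δ, hδ, hball⟩ := Metric.isOpen_iff.1 hv _ (hxv rfl)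
  refine ⟨δ, hδ, fun z y t hz hy ht _ => ?_⟩
  have h1 : (y, z, t) ∈ N' := huv ⟨hu (by simpa using hy.le), hball (by
    simp only [mem_ball_iff_norm, Prod.mk_sub_mk, Prod.norm_mk, sub_zero]
    exact max_lt hz ht)⟩
  simpa using (mem_ball_zero_iff.1 h1.2).le

theorem IsExtDiffQuot.apply_zero_eq {g' : E × E × 𝕂 → F} (hU : IsOpen U)
    (hg : IsExtDiffQuot 𝕂 U f g) (hg' : IsExtDiffQuot 𝕂 U f g') (hx : x ∈ U) (y : E) :
    g (x, y, 0) = g' (x, y, 0) :=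
  tendsto_nhds_unique (hg.tendsto_quot hU hx y) (hg'.tendsto_quot hU hx y)

theorem HasDifferentialAt.eq_of_hasFDerivAt (hU : IsOpen U) (hx : x ∈ U)
    (hA : HasDifferentialAt 𝕂 U f x A) {B : E →L[𝕂] F} (hB : HasFDerivAt f B x) : B = A := by
  obtain ⟨g, hg, hgA⟩ := hA
  ext y
  rw [← hgA]
  refine tendsto_nhds_unique ?_ (hg.tendsto_quot hU hx y)
  exact (hB.hasLineDerivAt y).tendsto_slope_zero

theorem HasDifferentialAt.hasStrictFDerivAt {c : DiffKind} {k : ℕ∞} (hk : 1 ≤ k)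
    (hC : c = .C → 2 ≤ k ∨ (LocallyCompactSpace 𝕂 ∧ FiniteDimensional 𝕂 E))
    (hU : IsOpen U) (hf : ∀ n : ℕ, (n : ℕ∞) ≤ k → Reg 𝕂 c n U f) (hx : x ∈ U)
    (hA : HasDifferentialAt 𝕂 U f x A) : HasStrictFDerivAt f A x := by
  have hmem : (x, (0 : E), (0 : 𝕂)) ∈ dom1 𝕂 U := ⟨hx, by simpa using hx⟩
  match c with
  | .SC =>
    obtain ⟨h, -⟩ := hf 1 (by exact_mod_cast hk)
    obtain ⟨B, hB⟩ := h x hx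
    exact hA.eq_of_hasFDerivAt hU hx hB.hasFDerivAt ▸ hB
  | .LC =>
    obtain ⟨-, g, hg, h⟩ := hf 1 (by exact_mod_cast hk)
    obtain ⟨g₀, hg₀, hA⟩ := hA
    obtain ⟨K, s, hs, hK⟩ := h _ hmem
    exact hg.hasStrictFDerivAt_of_lipschitz hU hx
      (fun y => (hg.apply_zero_eq hU hg₀ hx y).trans (hA y)) hs hK
  | .C =>
    obtain ⟨g₀, hg₀, hA⟩ := hA
    rcases hC rfl with h2 | ⟨_, _⟩
    -- For `k ≥ 2` the map `f^[1]` is `C^1`, hence locally Lipschitz.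
    · obtain ⟨-, g, hg, -, g', hg', -⟩ := hf 2 (by exact_mod_cast h2)
      obtain ⟨K, s, hs, hK⟩ := hg'.exists_lipschitzOnWith (isOpen_dom1 𝕂 hU) hmem
      exact hg.hasStrictFDerivAt_of_lipschitz hU hx
        (fun y => (hg.apply_zero_eq hU hg₀ hx y).trans (hA y)) hs hK
    · have := FiniteDimensional.proper 𝕂 E
      exact hg₀.hasStrictFDerivAt_of_properSpace hU hx hA

end StrictDifferentiability

/-! ### Regularity of the inverse, and the theorem. -/

section InverseFunction

variable {𝕂 : Type u} [NontriviallyNormedField 𝕂]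
variable {E : Type u} [NormedAddCommGroup E] [NormedSpace 𝕂 E] [CompleteSpace E]

/-- The inverse of a map which is close to an invertible linear map is as regular as the map. -/
theorem Reg.inverse {c : DiffKind} {n : ℕ} {V W : Set E} {f g : E → E} (hV : IsOpen V)
    (hW : IsOpen W) (hf : Reg 𝕂 c n V f) (A : E ≃L[𝕂] E)
    (hA : ApproximatesLinearOn f (A : E →L[𝕂] E) V (‖(A.symm : E →L[𝕂] E)‖₊⁻¹ / 2))
    (hgV : MapsTo g W V) (hfg : RightInvOn g f W) : Reg 𝕂 c n W g := by
  let B : E →L[𝕂] E := A.symm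
  let π₁ : E × E →L[𝕂] E := ContinuousLinearMap.fst 𝕂 E E
  let π₂ : E × E →L[𝕂] E := ContinuousLinearMap.snd 𝕂 E E
  -- `Λ ((y, u), f u) = u + B (y - f u)` is a Newton step with frozen derivative; its fixed points
  -- solve `f u = y`.
  let Λ : (E × E) × E →L[𝕂] E :=
    (π₂ + B.comp π₁).comp (ContinuousLinearMap.fst 𝕂 (E × E) E) -
      B.comp (ContinuousLinearMap.snd 𝕂 (E × E) E)
  have hΩ : IsOpen (W ×ˢ V) := hW.prod hV
  have hfπ : Reg 𝕂 c n (W ×ˢ V) (fun p => f (π₂ p)) :=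
    hf.comp (Reg.clm c n _ π₂) fun p hp => hp.2
  have hF : Reg 𝕂 c n (W ×ˢ V) (fun p => Λ (p, f (π₂ p))) :=
    (Reg.clm c n univ Λ).comp ((Reg.clm c n _ (ContinuousLinearMap.id 𝕂 (E × E))).prodMk hfπ)
      (mapsTo_univ _ _)
  have hΛ : ∀ y u, Λ ((y, u), f u) = u + B y - B (f u) := fun y u => rfl
  refine Reg.fixedPoint (θ := 1 / 2) (by norm_num) hW hΩ ?_ (fun y hy => ⟨hy, hgV hy⟩) ?_ hF
  · intro y u v hu hv
    have h1 : Λ ((y, u), f u) - Λ ((y, v), f v) = -B (f u - f v - A (u - v)) := by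
      have hBA : ∀ w, B (A w) = w := A.symm_apply_apply
      rw [hΛ, hΛ]
      simp only [map_sub, hBA]
      abel
    change ‖Λ ((y, u), f u) - Λ ((y, v), f v)‖ ≤ _
    rw [h1, norm_neg]
    have h2 := hA u hu.2 v hv.2
    -- Only an inequality, since `‖B‖ = 0` when `E` is trivial.
    have h3 : ‖B‖ * ‖B‖⁻¹ ≤ 1 := mul_inv_le_one
    push_cast at h2 ⊢
    calc ‖B (f u - f v - A (u - v))‖ ≤ ‖B‖ * ‖f u - f v - A (u - v)‖ := B.le_opNorm _
      _ ≤ ‖B‖ * (‖B‖⁻¹ / 2 * ‖u - v‖) := by gcongr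
      _ = (‖B‖ * ‖B‖⁻¹) * (1 / 2 * ‖u - v‖) := by ring
      _ ≤ 1 * (1 / 2 * ‖u - v‖) := by gcongr
      _ = _ := one_mul _
  · intro y hy
    change Λ ((y, g y), f (g y)) = g y
    rw [hΛ, hfg hy, add_sub_cancel_right]

end InverseFunction

end BGN

theorem theorem5p1 {𝕂 : Type u} [NontriviallyNormedField 𝕂]
    {E : Type u} [NormedAddCommGroup E] [NormedSpace 𝕂 E] [CompleteSpace E]
    (c : BGN.DiffKind) (k : ℕ∞) (hk : 1 ≤ k)
    (hC : c = BGN.DiffKind.C → 2 ≤ k ∨ (LocallyCompactSpace 𝕂 ∧ FiniteDimensional 𝕂 E))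
    (U : Set E) (hU : IsOpen U) (f : E → E) (hf : BGN.OfClass 𝕂 c k U f)
    (x : E) (hx : x ∈ U) (A : E →L[𝕂] E) (hA : BGN.HasDifferentialAt 𝕂 U f x A)
    (hGL : IsUnit A) :
    ∃ V : Set E, IsOpen V ∧ x ∈ V ∧ V ⊆ U ∧ IsOpen (f '' V) ∧
      BGN.IsDiffeoOn 𝕂 c k V (f '' V) f := by
  have hreg := (BGN.ofClass_iff hU).1 hf
  have hstrict := hA.hasStrictFDerivAt hk hC hU hreg hx
  obtain ⟨e, rfl⟩ : ∃ e : E ≃L[𝕂] E, (e : E →L[𝕂] E) = A := by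
    obtain ⟨S, rfl⟩ := hGL
    exact ⟨ContinuousLinearEquiv.ofUnit S, rfl⟩
  -- The set `s` depends only on the strict derivative at `x`, not on the order `n`, so one
  -- neighbourhood serves all orders, including `k = ∞`.
  obtain ⟨s, hxs, hs, happ⟩ := hstrict.approximates_deriv_on_open_nhds
  have hV : IsOpen (s ∩ U) := hs.inter hU
  replace happ := happ.mono_set (inter_subset_left (t := U))
  have hconst : Subsingleton E ∨
      ‖(e.symm : E →L[𝕂] E)‖₊⁻¹ / 2 < ‖(e.symm : E →L[𝕂] E)‖₊⁻¹ :=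
    e.subsingleton_or_nnnorm_symm_pos.imp id fun h =>
      NNReal.half_lt_self (inv_pos.2 h).ne'
  have hinj : InjOn f (s ∩ U) := happ.injOn hconst
  have hW : IsOpen (f '' (s ∩ U)) :=
    happ.open_image e.toNonlinearRightInverse hV hconst
  have hinv : InvOn (Function.invFunOn f (s ∩ U)) f (s ∩ U) (f '' (s ∩ U)) :=
    hinj.bijOn_image.invOn_invFunOn
  refine ⟨s ∩ U, hV, ⟨hxs, hx⟩, inter_subset_right, hW, hinj.bijOn_image, ?_, _, hinv, ?_⟩
  · exact (BGN.ofClass_iff hV).2 fun n hn => (hreg n hn).mono inter_subset_right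
  · exact (BGN.ofClass_iff hW).2 fun n hn =>
      ((hreg n hn).mono inter_subset_right).inverse hV hW e happ
        (fun y hy => Function.invFunOn_mem hy) hinv.2
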